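/- Let $n\ge 0$ and let $\|\cdot\|$ denote the spectral norm on $\mathbb{C}^{n\times n}$. A Schur factorization of $A\in\mathbb{C}^{n\times n}$ is a factorization $A=UTU^*$ with $U$ unitary and $T$ upper triangular. For an eigenvalue $\lambda$ of $A$ let $m_1(A,\lambda)\ge m_2(A,\lambda)\ge\cdots$ be the sizes of the blocks for $\lambda$ in the Jordan form of $A$, padded with zeros to a sequence of length $n$. If $\lambda_1,\dots,\lambda_q$ are the distinct eigenvalues of $A$, the Jordan structure of $A$ is the multiset (unordered family, with repetitions) $\Omega(A)$ of the $q$ sequences $(m_i(A,\lambda_j))_{i=1}^n$, $j=1,\dots,q$. Theorem 1.3 (Same Jordan structure. Lipschitz forward stability). Let $A_0\in\mathbb{C}^{n\times n}$. There exist constants $K,\varepsilon>0$, depending only on $A_0$, such that for every Schur factorization $A_0=U_0T_0U_0^*$ and every $A\in\mathbb{C}^{n\times n}$ with $\Omega(A)=\Omega(A_0)$ and $\|A-A_0\|<\varepsilon$ there is a Schur factorization $A=UTU^*$ with $$\|U-U_0\|+\|T-T_0\|\le K\,\|A-A_0\|.$$ -/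

import Mathlib

open scoped Matrix Matrix.Norms.L2Operator

/- The norm of a complex matrix is the spectral norm (the operator norm of the matrix acting on
`ℂⁿ` with its Euclidean norm). -/

namespace SchurStability

/-- `(U, T)` is a Schur factorization `A = U T U^*`: `U` is unitary and `T` is upper triangular. -/
def IsSchurFactorization {n : ℕ} (A U T : Matrix (Fin n) (Fin n) ℂ) : Prop :=
  U ∈ Matrix.unitaryGroup (Fin n) ℂ ∧ (∀ i j : Fin n, j < i → T i j = 0) ∧ A = U * T * Uᴴ

/-- The `k × k` Jordan block: `μ` on the diagonal, `1` on the first superdiagonal. -/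
def jordanBlock (μ : ℂ) (k : ℕ) : Matrix (Fin k) (Fin k) ℂ :=
  Matrix.of fun i j => if i = j then μ else if i.val + 1 = j.val then 1 else 0

/-- The block diagonal matrix whose `i`-th block is the Jordan block of size `s i` with
eigenvalue `μ i`. -/
def jordanMatrix {r : ℕ} (μ : Fin r → ℂ) (s : Fin r → ℕ) :
    Matrix (Σ i, Fin (s i)) (Σ i, Fin (s i)) ℂ :=
  Matrix.blockDiagonal' fun i => jordanBlock (μ i) (s i)

/-- The Jordan blocks with eigenvalues `μ i` and (positive) sizes `s i` form a Jordan form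
of `A`. -/
def IsJordanForm {n r : ℕ} (A : Matrix (Fin n) (Fin n) ℂ) (μ : Fin r → ℂ) (s : Fin r → ℕ) :
    Prop :=
  (∀ i, 0 < s i) ∧
    ∃ (e : (Σ i, Fin (s i)) ≃ Fin n) (S : GL (Fin n) ℂ),
      A = (S : Matrix (Fin n) (Fin n) ℂ) * Matrix.reindex e e (jordanMatrix μ s) *
        ((S⁻¹ : GL (Fin n) ℂ) : Matrix (Fin n) (Fin n) ℂ)

/-- The sizes `m_1(lam) ≥ m_2(lam) ≥ …` of all blocks with eigenvalue `lam`. The multiset carries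
the same information as the ordered sequence padded by zeros. -/
noncomputable def blockSizes {r : ℕ} (μ : Fin r → ℂ) (s : Fin r → ℕ) (lam : ℂ) : Multiset ℕ :=
  (Finset.univ.filter fun i => μ i = lam).val.map s

/-- The family, over the distinct eigenvalues, of the block sizes. The eigenvalues themselves are
forgotten, but not how many of them have given block sizes. -/
noncomputable def blockStructure {r : ℕ} (μ : Fin r → ℂ) (s : Fin r → ℕ) :
    Multiset (Multiset ℕ) :=
  (Finset.univ.image μ).val.map (blockSizes μ s)

/-- The set `𝒥(Ω)` of all `n × n` matrices whose Jordan structure is `Ω`. A Jordan form is unique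
up to the order of its blocks, so every matrix lies in `𝒥(Ω)` for exactly one `Ω`. -/
def jordanClass (n : ℕ) (Ω : Multiset (Multiset ℕ)) : Set (Matrix (Fin n) (Fin n) ℂ) :=
  {A | ∃ (r : ℕ) (μ : Fin r → ℂ) (s : Fin r → ℕ), IsJordanForm A μ s ∧ blockStructure μ s = Ω}

/-- `A` has the same Jordan structure as `A₀`, that is, `A ∈ 𝒥(Ω(A₀))`. -/
def SameJordanStructure {n : ℕ} (A A₀ : Matrix (Fin n) (Fin n) ℂ) : Prop :=
  ∃ Ω : Multiset (Multiset ℕ), A₀ ∈ jordanClass n Ω ∧ A ∈ jordanClass n Ω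

end SchurStability

/-!
Let `A` be close to `A₀` and have the same Jordan structure. The proof shows that
`A X = X q(A₀)` for some polynomial `q` and some matrix `X` with `‖X - 1‖ = O(‖A - A₀‖)`. Granted
this, let `A₀ = U₀ T₀ U₀ᴴ` be a Schur factorization. The matrix `U₀ᴴ q(A₀) U₀ = q(T₀)` is upper
triangular. If `U₀ᴴ X U₀ = Q R` is the QR factorization, then `U = U₀ Q` turns `A` into
`Uᴴ A U = R q(T₀) R⁻¹`, again upper triangular, and `‖U - U₀‖ = ‖Q - 1‖` is `O(‖X - 1‖)`
(`exists_qr_lipschitz`), with constants that do not involve `U₀` and `T₀`.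

The polynomial `q(A₀)` is `A₀` with its eigenvalues replaced by the nearby eigenvalues of `A` and
its Jordan chains kept. It is similar to `A` because the Jordan blocks of `A` at each eigenvalue
have the same sizes as those of `A₀` at the nearby one (`IsJordanForm.exists_eigenvalue_map`): ranks
of powers are lower semicontinuous, and the equality of the two Jordan structures leaves no room for
any of them to grow.

The matrices intertwining `A` and `q(A₀)` form the kernel of `X ↦ A X - X q(A₀)`, a linear operator
close to `X ↦ A₀ X - X A₀`. Because of the similarity, the dimension of this kernel is at least that
of the commutant of `A₀`. A kernel whose dimension does not drop moves in a Lipschitz way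
(`exists_ker_lipschitz`), so some intertwiner `X` is close to `1`, which lies in the commutant. This
bounds `‖X - 1‖` by `‖A - A₀‖` and the shift of the eigenvalues; the latter is itself
`O(‖A - A₀‖)` by taking traces (`exists_intertwiner_lipschitz`).
-/

namespace SchurStability

/-! ### Kernels under perturbation -/

section KernelPerturbation

variable {V W : Type*} [NormedAddCommGroup V] [NormedSpace ℂ V]
  [NormedAddCommGroup W] [NormedSpace ℂ W]

/-- Near `L₀`, operators are bounded below on a fixed complement of `ker L₀`. -/
theorem exists_isCompl_ker_bounded_below [FiniteDimensional ℂ V] (L₀ : V →L[ℂ] W) :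
    ∃ (V' : Submodule ℂ V) (c : ℝ), 0 < c ∧ IsCompl (LinearMap.ker (L₀ : V →ₗ[ℂ] W)) V' ∧
      ∀ L : V →L[ℂ] W, ‖L - L₀‖ < c → ∀ v ∈ V', c * ‖v‖ ≤ ‖L v‖ := by
  obtain ⟨V', hV'⟩ := (LinearMap.ker (L₀ : V →ₗ[ℂ] W)).exists_isCompl
  have hker : LinearMap.ker ((L₀ : V →ₗ[ℂ] W).domRestrict V') = ⊥ := by
    rw [LinearMap.ker_eq_bot']
    intro v hv
    have : (v : V) ∈ LinearMap.ker (L₀ : V →ₗ[ℂ] W) ⊓ V' := ⟨hv, v.2⟩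
    rw [hV'.inf_eq_bot] at this
    simpa using this
  obtain ⟨K, hK, hanti⟩ := LinearMap.exists_antilipschitzWith _ hker
  have hK' : (0 : ℝ) < K := hK
  refine ⟨V', (2 * (K : ℝ))⁻¹, by positivity, hV', fun L hL v hv => ?_⟩
  have h1 : ‖v‖ ≤ K * ‖L₀ v‖ := by
    simpa using hanti.le_mul_dist ⟨v, hv⟩ 0
  have h2 : ‖L₀ v‖ ≤ ‖L v‖ + ‖L - L₀‖ * ‖v‖ := by
    have : L₀ v = L v - (L - L₀) v := by simp
    rw [this]
    exact (norm_sub_le _ _).trans (by gcongr; exact (L - L₀).le_opNorm v)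
  have h3 : ‖L - L₀‖ * ‖v‖ ≤ (2 * (K : ℝ))⁻¹ * ‖v‖ := by gcongr
  have h4 : ‖v‖ / K ≤ ‖L₀ v‖ := by rwa [div_le_iff₀' hK']
  have h5 : ‖v‖ / K = (2 * (K : ℝ))⁻¹ * ‖v‖ + (2 * (K : ℝ))⁻¹ * ‖v‖ := by field_simp; ring
  linarith

theorem disjoint_ker_of_bounded_below {L : V →L[ℂ] W} {V' : Submodule ℂ V} {c : ℝ} (hc : 0 < c)
    (h : ∀ v ∈ V', c * ‖v‖ ≤ ‖L v‖) : Disjoint (LinearMap.ker (L : V →ₗ[ℂ] W)) V' := by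
  rw [Submodule.disjoint_def]
  intro v hv hv'
  have h1 := h v hv'
  have h0 : L v = 0 := hv
  rw [h0, norm_zero] at h1
  have : ‖v‖ ≤ 0 := by nlinarith [norm_nonneg v]
  simpa using this

/-- The dimension of the kernel is upper semicontinuous. -/
theorem exists_finrank_ker_le [FiniteDimensional ℂ V] (L₀ : V →L[ℂ] W) :
    ∃ c : ℝ, 0 < c ∧ ∀ L : V →L[ℂ] W, ‖L - L₀‖ < c →
      Module.finrank ℂ (LinearMap.ker (L : V →ₗ[ℂ] W)) ≤
        Module.finrank ℂ (LinearMap.ker (L₀ : V →ₗ[ℂ] W)) := by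
  obtain ⟨V', c, hc, hV', h⟩ := exists_isCompl_ker_bounded_below L₀
  refine ⟨c, hc, fun L hL => ?_⟩
  have h1 := Submodule.finrank_add_finrank_le_of_disjoint
    (disjoint_ker_of_bounded_below hc (h L hL))
  have h2 := Submodule.finrank_add_eq_of_isCompl hV'
  omega

/-- As long as its dimension does not drop, the kernel depends on the operator in a Lipschitz way:
the error of splitting `x ∈ ker L₀` along `V = ker L ⊕ V'`, with `V'` a complement of `ker L₀`, is
controlled by `‖L x‖ = ‖(L - L₀) x‖`. -/
theorem exists_ker_lipschitz [FiniteDimensional ℂ V] (L₀ : V →L[ℂ] W) :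
    ∃ C c : ℝ, 0 < C ∧ 0 < c ∧ ∀ L : V →L[ℂ] W, ‖L - L₀‖ < c →
      Module.finrank ℂ (LinearMap.ker (L₀ : V →ₗ[ℂ] W)) ≤
        Module.finrank ℂ (LinearMap.ker (L : V →ₗ[ℂ] W)) →
      ∀ x : V, L₀ x = 0 → ∃ y : V, L y = 0 ∧ ‖y - x‖ ≤ C * ‖L - L₀‖ * ‖x‖ := by
  obtain ⟨V', c, hc, hV', h⟩ := exists_isCompl_ker_bounded_below L₀
  refine ⟨c⁻¹, c, by positivity, hc, fun L hL hdim x hx => ?_⟩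
  have hdisj := disjoint_ker_of_bounded_below hc (h L hL)
  have htop : LinearMap.ker (L : V →ₗ[ℂ] W) ⊔ V' = ⊤ := by
    refine Submodule.eq_top_of_disjoint _ _ ?_ hdisj
    rw [← Submodule.finrank_add_eq_of_isCompl hV']
    omega
  obtain ⟨y, hy, v, hv, hyv⟩ := Submodule.mem_sup.1 (htop ▸ Submodule.mem_top : x ∈ _ ⊔ _)
  have hy0 : L y = 0 := hy
  refine ⟨y, hy0, ?_⟩
  have h1 := h L hL v hv
  have h2 : L v = (L - L₀) x := by
    rw [sub_apply, hx, ← hyv, map_add, hy0]; simp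
  rw [h2] at h1
  have h3 : ‖y - x‖ = ‖v‖ := by rw [← hyv]; simp
  rw [h3, mul_assoc, inv_mul_eq_div, le_div_iff₀' hc]
  exact h1.trans ((L - L₀).le_opNorm x)

end KernelPerturbation

/-! ### QR factorization near the identity -/

section QR

variable {n : ℕ}

theorem norm_entry_le (M : Matrix (Fin n) (Fin n) ℂ) (i j : Fin n) : ‖M i j‖ ≤ ‖M‖ := by
  have h := Matrix.l2_opNorm_mulVec M (EuclideanSpace.single j 1)
  have h2 := PiLp.norm_apply_le (WithLp.toLp 2 (M *ᵥ (EuclideanSpace.single j (1 : ℂ)).ofLp)) i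
  simp only [PiLp.ofLp_single, Matrix.mulVec_single_one, PiLp.norm_single, norm_one, mul_one] at h h2
  simpa using h2.trans h

theorem exists_norm_le_of_entries (n : ℕ) : ∃ C : ℝ, 0 < C ∧
    ∀ (M : Matrix (Fin n) (Fin n) ℂ) (b : ℝ), 0 ≤ b → (∀ i j, ‖M i j‖ ≤ b) → ‖M‖ ≤ C * b := by
  refine ⟨∑ i : Fin n, ∑ j : Fin n, ‖Matrix.single i j (1 : ℂ)‖ + 1, by positivity,
    fun M b hb h => ?_⟩
  have h1 : ‖M‖ ≤ ∑ i : Fin n, ∑ j : Fin n, ‖Matrix.single i j (1 : ℂ)‖ * b := by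
    conv_lhs => rw [Matrix.matrix_eq_sum_single M]
    refine norm_sum_le_of_le _ fun i _ => norm_sum_le_of_le _ fun j _ => ?_
    have : Matrix.single i j (M i j) = M i j • Matrix.single i j (1 : ℂ) := by simp
    rw [this, norm_smul, mul_comm]
    gcongr
    exact h i j
  simp only [← Finset.sum_mul] at h1
  linarith

/-- The QR factorization of an invertible matrix, with the diagonal of `R` normalized to be
positive. -/
theorem exists_qr (W : Matrix (Fin n) (Fin n) ℂ) (hW : IsUnit W) :
    ∃ Q R : Matrix (Fin n) (Fin n) ℂ, Q ∈ Matrix.unitaryGroup (Fin n) ℂ ∧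
      R.BlockTriangular id ∧ W = Q * R ∧ ∀ i, ∃ r : ℝ, 0 < r ∧ R i i = r := by
  set a := EuclideanSpace.basisFun (Fin n) ℂ
  let f : Fin n → EuclideanSpace ℂ (Fin n) := fun j => WithLp.toLp 2 (fun i => W i j)
  have hcard : Module.finrank ℂ (EuclideanSpace ℂ (Fin n)) = Fintype.card (Fin n) := by simp
  set b := InnerProductSpace.gramSchmidtOrthonormalBasis hcard f
  have hR := InnerProductSpace.gramSchmidtOrthonormalBasis_inv_isUpperTriangular hcard f
  set R := b.toBasis.toMatrix f
  set Q := a.toBasis.toMatrix b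
  have hQ : Q ∈ Matrix.unitaryGroup (Fin n) ℂ := a.toMatrix_orthonormalBasis_mem_unitary b
  have hQR : W = Q * R := by
    have h := Module.Basis.toMatrix_mul_toMatrix a.toBasis b.toBasis f
    rw [OrthonormalBasis.coe_toBasis] at h
    rw [h]
    ext i j
    simp [Module.Basis.toMatrix_apply, a, f]
  have hRu : IsUnit R.det := by
    have := (Matrix.isUnit_iff_isUnit_det _).1 hW
    rw [hQR, Matrix.det_mul] at this
    exact isUnit_of_mul_isUnit_right this
  have hdiag : ∀ i, R i i ≠ 0 := by
    rw [Matrix.det_of_isUpperTriangular hR] at hRu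
    intro i
    exact Finset.prod_ne_zero_iff.1 hRu.ne_zero i (Finset.mem_univ i)
  let d : Fin n → ℂ := fun i => R i i / ‖R i i‖
  have hn : ∀ i, (‖R i i‖ : ℂ) ≠ 0 := fun i => by
    exact_mod_cast norm_ne_zero_iff.2 (hdiag i)
  have hd : ∀ i, star (d i) * R i i = ‖R i i‖ := by
    intro i
    have : star (R i i) * R i i = (‖R i i‖ : ℂ) ^ 2 := by
      simpa using Complex.conj_mul' (R i i)
    simp only [d, star_div₀, Complex.star_def, Complex.conj_ofReal] at this ⊢
    rw [div_mul_eq_mul_div, this, sq, mul_div_assoc, div_self (hn i), mul_one]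
  have hd1 : ∀ i, star (d i) * d i = 1 := by
    intro i
    simp only [d]
    rw [mul_div_assoc', hd i, div_self (hn i)]
  have hD : Matrix.diagonal d * (Matrix.diagonal d)ᴴ = 1 := by
    rw [Matrix.diagonal_conjTranspose, Matrix.diagonal_mul_diagonal, ← Matrix.diagonal_one]
    congr 1
    ext i
    rw [mul_comm]
    exact hd1 i
  refine ⟨Q * Matrix.diagonal d, (Matrix.diagonal d)ᴴ * R, ?_, ?_, ?_, fun i => ?_⟩
  · exact mul_mem hQ (Matrix.mem_unitaryGroup_iff.2 hD)
  · rw [Matrix.diagonal_conjTranspose]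
    exact (Matrix.blockTriangular_diagonal _).mul hR
  · rw [hQR, Matrix.mul_assoc, ← Matrix.mul_assoc (Matrix.diagonal d), hD, Matrix.one_mul]
  · refine ⟨‖R i i‖, norm_pos_iff.2 (hdiag i), ?_⟩
    rw [Matrix.diagonal_conjTranspose, Matrix.diagonal_mul]
    exact hd i

/-- The unitary factor of the QR factorization is Lipschitz at `1`. With `W = Q R`, the matrix
`R - (R⁻¹)ᴴ = Qᴴ (W - (W⁻¹)ᴴ)` is small; its strict upper part is that of `R`, and its diagonal
entries `r - 1 / r` dominate `r - 1`. -/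
theorem exists_qr_lipschitz (n : ℕ) : ∃ C ρ : ℝ, 0 < C ∧ 0 < ρ ∧
    ∀ W : Matrix (Fin n) (Fin n) ℂ, ‖W - 1‖ < ρ →
      ∃ Q R : Matrix (Fin n) (Fin n) ℂ, Q ∈ Matrix.unitaryGroup (Fin n) ℂ ∧
        R.BlockTriangular id ∧ IsUnit R ∧ W = Q * R ∧ ‖Q - 1‖ ≤ C * ‖W - 1‖ := by
  obtain ⟨C, hC, hCn⟩ := exists_norm_le_of_entries n
  obtain ⟨ρ₁, hρ₁, hinv⟩ : ∃ ρ : ℝ, 0 < ρ ∧ ∀ W : Matrix (Fin n) (Fin n) ℂ, ‖W - 1‖ < ρ →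
      IsUnit W ∧ ‖W⁻¹ - 1‖ ≤ 2 * ‖W - 1‖ := by
    refine ⟨1 / 2, by norm_num, fun W hW => ?_⟩
    have hu : IsUnit W := by
      have := isUnit_one_sub_of_norm_lt_one (x := 1 - W)
        (by rw [norm_sub_rev]; linarith)
      simpa using this
    refine ⟨hu, ?_⟩
    have hmul : W⁻¹ * W = 1 := Matrix.nonsing_inv_mul W ((Matrix.isUnit_iff_isUnit_det W).1 hu)
    have h1 : W⁻¹ - 1 = -((W⁻¹ - 1) * (W - 1)) - (W - 1) := by
      rw [sub_mul, mul_sub, hmul]; simp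
    have h2 : ‖W⁻¹ - 1‖ ≤ ‖W⁻¹ - 1‖ * ‖W - 1‖ + ‖W - 1‖ := by
      conv_lhs => rw [h1]
      refine (norm_sub_le _ _).trans ?_
      rw [norm_neg]
      gcongr
      exact norm_mul_le _ _
    nlinarith [norm_nonneg (W⁻¹ - 1)]
  refine ⟨C * 3 + 1, ρ₁, by positivity, hρ₁, fun W hW => ?_⟩
  obtain ⟨hu, hWinv⟩ := hinv W hW
  obtain ⟨Q, R, hQ, hR, hQR, hdiag⟩ := exists_qr W hu
  have hQ1 : Qᴴ * Q = 1 := Matrix.mem_unitaryGroup_iff'.1 hQ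
  have hQ2 : Q * Qᴴ = 1 := Matrix.mem_unitaryGroup_iff.1 hQ
  have hRW : R = Qᴴ * W := by rw [hQR, ← Matrix.mul_assoc, hQ1, Matrix.one_mul]
  have hdet := (Matrix.isUnit_iff_isUnit_det W).1 hu
  have hRu : IsUnit R := by
    rw [hRW]
    exact (IsUnit.of_mul_eq_one Q hQ1).mul hu
  have hRdet := (Matrix.isUnit_iff_isUnit_det R).1 hRu
  refine ⟨Q, R, hQ, hR, hRu, hQR, ?_⟩
  have hRinv : R⁻¹ = W⁻¹ * Q := by
    refine Matrix.inv_eq_left_inv ?_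
    rw [hRW, Matrix.mul_assoc, ← Matrix.mul_assoc Q, hQ2, Matrix.one_mul,
      Matrix.nonsing_inv_mul W hdet]
  have hRtri : (R⁻¹).BlockTriangular id := by
    let := R.invertibleOfIsUnitDet hRdet
    exact Matrix.blockTriangular_inv_of_blockTriangular hR
  have hX : R - (R⁻¹)ᴴ = Qᴴ * (W - (W⁻¹)ᴴ) := by
    rw [hRinv, Matrix.conjTranspose_mul, mul_sub, ← hRW]
  have hXn : ‖R - (R⁻¹)ᴴ‖ ≤ 3 * ‖W - 1‖ := by
    have hQ' : Qᴴ ∈ Matrix.unitaryGroup (Fin n) ℂ := Unitary.star_mem hQ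
    rw [hX, CStarRing.norm_mem_unitary_mul _ hQ']
    have : W - (W⁻¹)ᴴ = (W - 1) - (W⁻¹ - 1)ᴴ := by simp
    rw [this]
    refine (norm_sub_le _ _).trans ?_
    rw [Matrix.l2_opNorm_conjTranspose]
    linarith
  have hRn : ‖R - 1‖ ≤ C * (3 * ‖W - 1‖) := by
    refine hCn _ _ (by positivity) fun i j => ?_
    have hij := (norm_entry_le (R - (R⁻¹)ᴴ) i j).trans hXn
    rcases lt_trichotomy i j with h | h | h
    · have h0 : (R⁻¹)ᴴ i j = 0 := by
        rw [Matrix.conjTranspose_apply, hRtri (by simpa using h), star_zero]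
      rw [Matrix.sub_apply, h0, sub_zero] at hij
      simpa [Matrix.one_apply_ne h.ne] using hij
    · subst h
      obtain ⟨r, hr, hri⟩ := hdiag i
      have hprod : R i i * R⁻¹ i i = 1 := by
        have h1 : (R * R⁻¹) i i = 1 := by rw [Matrix.mul_nonsing_inv R hRdet]; simp
        rw [Matrix.mul_apply, Finset.sum_eq_single i] at h1
        · exact h1
        · intro k _ hk
          rcases lt_or_gt_of_ne hk with h | h
          · rw [hR (by simpa using h), zero_mul]
          · rw [hRtri (by simpa using h), mul_zero]
        · simp
      have hrinv : R⁻¹ i i = ((r⁻¹ : ℝ) : ℂ) := by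
        rw [hri] at hprod
        rw [Complex.ofReal_inv]
        exact eq_inv_of_mul_eq_one_right hprod
      rw [Matrix.sub_apply, Matrix.conjTranspose_apply, hri, hrinv, Complex.star_def,
        Complex.conj_ofReal, ← Complex.ofReal_sub, Complex.norm_real] at hij
      rw [Matrix.sub_apply, Matrix.one_apply_eq, hri, ← Complex.ofReal_one, ← Complex.ofReal_sub,
        Complex.norm_real]
      refine le_trans ?_ hij
      have : r - r⁻¹ = (r - 1) * (1 + r⁻¹) := by field_simp; ring
      rw [this, norm_mul]
      refine le_mul_of_one_le_right (norm_nonneg _) ?_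
      rw [Real.norm_of_nonneg (by positivity)]
      have : 0 < r⁻¹ := by positivity
      linarith
    · have h0 : (R - 1 : Matrix (Fin n) (Fin n) ℂ) i j = 0 := by
        rw [Matrix.sub_apply, Matrix.one_apply_ne h.ne', hR (by simpa using h), sub_zero]
      rw [h0, norm_zero]
      positivity
  have hQ1' : Q - 1 = Q * (1 - R) + (W - 1) := by rw [mul_sub, ← hQR]; simp
  rw [hQ1']
  refine (norm_add_le _ _).trans ?_
  rw [CStarRing.norm_mem_unitary_mul _ hQ, norm_sub_rev]
  linarith

end QR

/-! ### Jordan forms and ranks of powers -/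

section JordanInvariants

variable {r : ℕ} (μ : Fin r → ℂ) (s : Fin r → ℕ)

theorem jordanMatrix_apply (x y : Σ i, Fin (s i)) :
    jordanMatrix μ s x y = if x.1 = y.1 then
      (if x.2.val = y.2.val then μ x.1 else if x.2.val + 1 = y.2.val then 1 else 0) else 0 := by
  obtain ⟨i, a⟩ := x
  obtain ⟨j, b⟩ := y
  by_cases h : i = j
  · subst h
    simp [jordanMatrix, Matrix.blockDiagonal'_apply_eq, jordanBlock, Fin.ext_iff]
  · simp [jordanMatrix, Matrix.blockDiagonal'_apply_ne _ _ _ h, h]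

theorem jordanMatrix_add_diagonal (g : Fin r → ℂ) :
    jordanMatrix μ s + Matrix.diagonal (fun x => g x.1) = jordanMatrix (μ + g) s := by
  ext ⟨i, a⟩ ⟨j, b⟩
  simp only [Matrix.add_apply, jordanMatrix_apply, Matrix.diagonal_apply]
  by_cases h : i = j
  · subst h
    by_cases hab : a = b
    · simp [hab]
    · have : a.val ≠ b.val := fun h => hab (Fin.ext h)
      simp [hab, this]
  · simp [h]

theorem jordanMatrix_sub_smul_one (c : ℂ) :
    jordanMatrix μ s - c • 1 = jordanMatrix (fun i => μ i - c) s := by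
  have h := jordanMatrix_add_diagonal μ s (fun _ => -c)
  have h2 : Matrix.diagonal (fun _ : Σ i, Fin (s i) => -c) = -(c • 1) := by
    rw [← Matrix.diagonal_neg, Matrix.smul_one_eq_diagonal]
  rw [h2, ← sub_eq_add_neg] at h
  rw [h]
  congr 1

theorem jordanMatrix_mulVec (v : (Σ i, Fin (s i)) → ℂ) (i : Fin r) (a : Fin (s i)) :
    (jordanMatrix μ s *ᵥ v) ⟨i, a⟩ =
      μ i * v ⟨i, a⟩ + if h : a.val + 1 < s i then v ⟨i, ⟨a.val + 1, h⟩⟩ else 0 := by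
  have h1 : (jordanMatrix μ s *ᵥ v) ⟨i, a⟩ =
      ∑ b : Fin (s i), ((if b = a then μ i * v ⟨i, b⟩ else 0) +
        if b.val = a.val + 1 then v ⟨i, b⟩ else 0) := by
    rw [Matrix.mulVec, dotProduct, Fintype.sum_sigma, Finset.sum_eq_single i]
    · refine Finset.sum_congr rfl fun b _ => ?_
      rw [jordanMatrix_apply]
      by_cases hab : b = a
      · subst hab; simp
      · have h1 : ¬ a.val = b.val := fun h => hab (Fin.ext h.symm)
        simp [hab, h1, eq_comm]
    · intro j _ hj
      refine Finset.sum_eq_zero fun b _ => ?_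
      rw [jordanMatrix_apply]
      simp [hj.symm]
    · simp
  rw [h1, Finset.sum_add_distrib]
  congr 1
  · simp
  · split_ifs with h
    · rw [Finset.sum_eq_single ⟨a.val + 1, h⟩]
      · simp
      · intro b _ hb
        rw [if_neg fun h' => hb (Fin.ext h')]
      · simp
    · refine Finset.sum_eq_zero fun b _ => ?_
      rw [if_neg]
      have := b.2
      omega

/-- The dimension of the kernel of `(A - c)^k` for a matrix `A` with Jordan blocks `(μ, s)`,
see `rank_sub_smul_one_pow`. -/
noncomputable def kerDim (c : ℂ) (k : ℕ) : ℕ := ∑ i with μ i = c, min (s i) k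

theorem jordanMatrix_pow_mulVec_eq_zero_iff (c : ℂ) (k : ℕ) (v : (Σ i, Fin (s i)) → ℂ) :
    (jordanMatrix (fun i => μ i - c) s ^ k) *ᵥ v = 0 ↔
      ∀ x : Σ i, Fin (s i), (μ x.1 = c → k ≤ x.2.val) → v x = 0 := by
  induction k generalizing v with
  | zero => simp [funext_iff]
  | succ k ih =>
    rw [pow_succ, ← Matrix.mulVec_mulVec, ih]
    constructor
    · rintro h ⟨i, a⟩ hx
      by_cases hi : μ i = c
      · have ha : k + 1 ≤ a.val := hx hi
        have h1 := h ⟨i, ⟨a.val - 1, by omega⟩⟩ (fun _ => by simp only; omega)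
        rw [jordanMatrix_mulVec] at h1
        have h2 : a.val - 1 + 1 < s i := by omega
        simp only [hi, sub_self, zero_mul, zero_add, h2, dite_true] at h1
        rw [← h1]
        congr 2
        ext
        simp only
        omega
      · -- downward induction along the block
        have key : ∀ d : ℕ, ∀ a : Fin (s i), s i ≤ a.val + 1 + d → v ⟨i, a⟩ = 0 := by
          intro d
          induction d with
          | zero =>
            intro a ha
            have h1 := h ⟨i, a⟩ (fun h => absurd h hi)
            rw [jordanMatrix_mulVec, dif_neg (by omega), add_zero] at h1
            exact (mul_eq_zero.1 h1).resolve_left (sub_ne_zero.2 hi)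
          | succ d ihd =>
            intro a ha
            have h1 := h ⟨i, a⟩ (fun h => absurd h hi)
            rw [jordanMatrix_mulVec] at h1
            have h2 : (if h : a.val + 1 < s i then v ⟨i, ⟨a.val + 1, h⟩⟩ else 0) = 0 := by
              split_ifs
              · exact ihd _ (by simp only; omega)
              · rfl
            rw [h2, add_zero] at h1
            exact (mul_eq_zero.1 h1).resolve_left (sub_ne_zero.2 hi)
        exact key (s i) a (by omega)
    · rintro h ⟨i, a⟩ hx
      rw [jordanMatrix_mulVec]
      have h2 : (if h : a.val + 1 < s i then v ⟨i, ⟨a.val + 1, h⟩⟩ else 0) = 0 := by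
        split_ifs
        · exact h _ (fun hi => by have := hx hi; simp only at this ⊢; omega)
        · rfl
      rw [h2, add_zero]
      by_cases hi : μ i = c
      · simp [hi]
      · rw [h ⟨i, a⟩ (fun h => absurd h hi), mul_zero]

theorem card_jordan_index (c : ℂ) (k : ℕ) :
    Fintype.card {x : Σ i, Fin (s i) // μ x.1 = c ∧ x.2.val < k} = kerDim μ s c k := by
  rw [Fintype.card_subtype, kerDim]
  have : (Finset.univ.filter fun x : Σ i, Fin (s i) => μ x.1 = c ∧ x.2.val < k) =
      (Finset.univ.filter fun i => μ i = c).sigma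
        (fun i => Finset.univ.filter fun a : Fin (s i) => a.val < k) := by
    ext ⟨i, a⟩
    simp
  rw [this, Finset.card_sigma]
  refine Finset.sum_congr rfl fun i _ => ?_
  rw [Fin.card_filter_val_lt]

theorem rank_jordanMatrix_sub_pow (c : ℂ) (k : ℕ) :
    ((jordanMatrix μ s - c • 1) ^ k).rank + kerDim μ s c k = ∑ i, s i := by
  rw [jordanMatrix_sub_smul_one]
  set M := jordanMatrix (fun i => μ i - c) s ^ k
  have h := LinearMap.finrank_range_add_finrank_ker M.mulVecLin
  have hc : Module.finrank ℂ ((Σ i, Fin (s i)) → ℂ) = ∑ i, s i := by simp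
  rw [hc] at h
  rw [← h, Matrix.rank]
  congr 1
  have hker : LinearMap.ker M.mulVecLin =
      ⨅ x ∈ {x : Σ i, Fin (s i) | μ x.1 = c → k ≤ x.2.val},
        LinearMap.ker (LinearMap.proj x : ((Σ i, Fin (s i)) → ℂ) →ₗ[ℂ] ℂ) := by
    ext v
    rw [LinearMap.mem_ker, Matrix.mulVecLin_apply, jordanMatrix_pow_mulVec_eq_zero_iff]
    simp
  classical
  have hd : Disjoint {x : Σ i, Fin (s i) | μ x.1 = c ∧ x.2.val < k}
      {x : Σ i, Fin (s i) | μ x.1 = c → k ≤ x.2.val} := by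
    rw [Set.disjoint_left]
    rintro x ⟨h1, h2⟩ h3
    exact absurd (h3 h1) (by omega)
  have hu : Set.univ ⊆ {x : Σ i, Fin (s i) | μ x.1 = c ∧ x.2.val < k} ∪
      {x : Σ i, Fin (s i) | μ x.1 = c → k ≤ x.2.val} := by
    intro x _
    by_cases h : μ x.1 = c → k ≤ x.2.val
    · exact Or.inr h
    · push Not at h
      exact Or.inl h
  rw [hker, (LinearMap.iInfKerProjEquiv ℂ (fun _ => ℂ) hd hu).finrank_eq,
    Module.finrank_fintype_fun_eq_card, ← card_jordan_index]
  exact Fintype.card_congr (Equiv.refl _)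

theorem det_jordanMatrix : (jordanMatrix μ s).det = ∏ i, μ i ^ s i := by
  -- In the lexicographic order of the index set the Jordan matrix is upper triangular.
  have htri : (Matrix.reindex toLex toLex (jordanMatrix μ s)).IsUpperTriangular := by
    intro x y hxy
    obtain ⟨⟨i, a⟩, rfl⟩ := toLex.surjective x
    obtain ⟨⟨j, b⟩, rfl⟩ := toLex.surjective y
    simp only [Matrix.reindex_apply, Matrix.submatrix_apply, toLex_symm_eq, ofLex_toLex]
    rw [jordanMatrix_apply]
    rcases Sigma.Lex.lt_def.1 hxy with h | ⟨h, h'⟩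
    · rw [if_neg]
      exact ne_of_gt h
    · change j = i at h
      subst h
      have h'' : b.val < a.val := h'
      rw [if_pos rfl, if_neg (by simp only; omega), if_neg (by simp only; omega)]
  rw [← Matrix.det_reindex_self (toLex : (Σ i, Fin (s i)) ≃ Lex (Σ i, Fin (s i))),
    Matrix.det_of_isUpperTriangular htri,
    ← Equiv.prod_comp (toLex : (Σ i, Fin (s i)) ≃ Lex (Σ i, Fin (s i))), Fintype.prod_sigma]
  simp [jordanMatrix_apply]

variable {μ s}

section IsJordanForm

variable {n : ℕ} {A : Matrix (Fin n) (Fin n) ℂ}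

theorem IsJordanForm.sum_sizes (h : IsJordanForm A μ s) : ∑ i, s i = n := by
  obtain ⟨_, e, _⟩ := h
  simpa using Fintype.card_congr e

theorem IsJordanForm.size_le (h : IsJordanForm A μ s) (i : Fin r) : s i ≤ n := by
  rw [← h.sum_sizes]
  exact Finset.single_le_sum (fun _ _ => Nat.zero_le _) (Finset.mem_univ i)

theorem conj_sub_smul_one (S : GL (Fin n) ℂ) (M : Matrix (Fin n) (Fin n) ℂ) (c : ℂ) :
    (S : Matrix (Fin n) (Fin n) ℂ) * M * ((S⁻¹ : GL (Fin n) ℂ) : Matrix (Fin n) (Fin n) ℂ) -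
        c • 1 =
      S * (M - c • 1) * ((S⁻¹ : GL (Fin n) ℂ) : Matrix (Fin n) (Fin n) ℂ) := by
  rw [mul_sub, sub_mul]
  simp

theorem IsJordanForm.rank_sub_smul_one_pow (h : IsJordanForm A μ s) (c : ℂ) (k : ℕ) :
    ((A - c • 1) ^ k).rank + kerDim μ s c k = n := by
  have hs := h.sum_sizes
  obtain ⟨_, e, S, rfl⟩ := h
  have h1 : Matrix.reindex e e (jordanMatrix μ s) - c • 1 =
      Matrix.reindexAlgEquiv ℂ ℂ e (jordanMatrix μ s - c • 1) := by
    rw [map_sub, map_smul, map_one]; rfl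
  rw [conj_sub_smul_one, Units.conj_pow S, h1, ← map_pow, mul_assoc,
    Matrix.rank_mul_eq_right_of_isUnit_det _ _ ((Matrix.isUnit_iff_isUnit_det _).1 S.isUnit),
    Matrix.rank_mul_eq_left_of_isUnit_det _ _ ((Matrix.isUnit_iff_isUnit_det _).1 S⁻¹.isUnit),
    Matrix.coe_reindexAlgEquiv, Matrix.rank_reindex, rank_jordanMatrix_sub_pow, hs]

theorem IsJordanForm.det_sub_smul_one (h : IsJordanForm A μ s) (c : ℂ) :
    (A - c • 1).det = ∏ i, (μ i - c) ^ s i := by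
  obtain ⟨_, e, S, rfl⟩ := h
  have h1 : Matrix.reindex e e (jordanMatrix μ s) - c • 1 =
      Matrix.reindexAlgEquiv ℂ ℂ e (jordanMatrix μ s - c • 1) := by
    rw [map_sub, map_smul, map_one]; rfl
  rw [conj_sub_smul_one, Matrix.det_units_conj, h1, Matrix.coe_reindexAlgEquiv,
    Matrix.det_reindex_self, jordanMatrix_sub_smul_one, det_jordanMatrix]

theorem kerDim_one_ne_zero_iff (hs : ∀ i, 0 < s i) (c : ℂ) :
    kerDim μ s c 1 ≠ 0 ↔ c ∈ Finset.univ.image μ := by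
  have h1 : kerDim μ s c 1 = (Finset.univ.filter fun i => μ i = c).card := by
    rw [kerDim, Finset.card_eq_sum_ones]
    refine Finset.sum_congr rfl fun i _ => ?_
    have := hs i
    omega
  rw [h1, Finset.card_ne_zero]
  simp [Finset.Nonempty]

theorem IsJordanForm.kerDim_eq {r' : ℕ} {μ' : Fin r' → ℂ} {s' : Fin r' → ℕ}
    (h : IsJordanForm A μ s) (h' : IsJordanForm A μ' s') : kerDim μ s = kerDim μ' s' := by
  ext c k
  have h1 := h.rank_sub_smul_one_pow c k
  have h2 := h'.rank_sub_smul_one_pow c k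
  omega

theorem IsJordanForm.image_eq {r' : ℕ} {μ' : Fin r' → ℂ} {s' : Fin r' → ℕ}
    (h : IsJordanForm A μ s) (h' : IsJordanForm A μ' s') :
    Finset.univ.image μ = Finset.univ.image μ' := by
  ext c
  rw [← kerDim_one_ne_zero_iff h.1, ← kerDim_one_ne_zero_iff h'.1, h.kerDim_eq h']

end IsJordanForm

theorem card_image_eq_of_blockStructure_eq {r' : ℕ} {μ' : Fin r' → ℂ} {s' : Fin r' → ℕ}
    (h : blockStructure μ s = blockStructure μ' s') :
    (Finset.univ.image μ).card = (Finset.univ.image μ').card := by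
  have := congrArg Multiset.card h
  simpa only [blockStructure, Multiset.card_map, Finset.card_val] using this

theorem sum_kerDim_eq_of_blockStructure_eq {r' : ℕ} {μ' : Fin r' → ℂ} {s' : Fin r' → ℕ}
    (h : blockStructure μ s = blockStructure μ' s') (m : ℕ) :
    ∑ c ∈ Finset.univ.image μ, ∑ k ∈ Finset.range m, kerDim μ s c k =
      ∑ c ∈ Finset.univ.image μ', ∑ k ∈ Finset.range m, kerDim μ' s' c k := by
  have key : ∀ {r : ℕ} (μ : Fin r → ℂ) (s : Fin r → ℕ),
      ∑ c ∈ Finset.univ.image μ, ∑ k ∈ Finset.range m, kerDim μ s c k =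
        ((blockStructure μ s).map
          fun b => ∑ k ∈ Finset.range m, (b.map fun t => min t k).sum).sum := by
    intro r μ s
    rw [blockStructure, Multiset.map_map, Finset.sum_map_val]
    refine Finset.sum_congr rfl fun c _ => Finset.sum_congr rfl fun k _ => ?_
    rw [blockSizes, Multiset.map_map, Finset.sum_map_val]
    rfl
  rw [key, key, h]

theorem card_filter_add_kerDim (c : ℂ) (t : ℕ) :
    (Finset.univ.filter fun i => μ i = c ∧ s i = t + 1).card + kerDim μ s c t +
      kerDim μ s c (t + 2) = 2 * kerDim μ s c (t + 1) := by
  rw [← Finset.filter_filter, Finset.card_filter]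
  simp only [kerDim, Finset.mul_sum, ← Finset.sum_add_distrib]
  refine Finset.sum_congr rfl fun i _ => ?_
  split_ifs <;> omega

/-- The dimensions of the kernels of the powers of `A - c` determine the Jordan blocks: the number
of blocks of size `t` is minus the second difference of `k ↦ kerDim μ s c k` at `t`. -/
theorem exists_equiv_of_kerDim_eq {r' : ℕ} {μ' : Fin r' → ℂ} {s' : Fin r' → ℕ} {m : ℕ}
    (hs : ∀ i, 0 < s i ∧ s i < m) (hs' : ∀ i, 0 < s' i ∧ s' i < m)
    (h : ∀ c, ∀ k ≤ m, kerDim μ s c k = kerDim μ' s' c k) :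
    ∃ σ : Fin r ≃ Fin r', ∀ i, μ' (σ i) = μ i ∧ s' (σ i) = s i := by
  have hcard : ∀ p : ℂ × ℕ, Fintype.card {i // (μ i, s i) = p} =
      Fintype.card {i // (μ' i, s' i) = p} := by
    rintro ⟨c, t⟩
    simp only [Fintype.card_subtype, Prod.mk.injEq]
    by_cases ht : 0 < t ∧ t < m
    · obtain ⟨t, rfl⟩ := Nat.exists_eq_succ_of_ne_zero ht.1.ne'
      have h1 := card_filter_add_kerDim (μ := μ) (s := s) c t
      have h2 := card_filter_add_kerDim (μ := μ') (s := s') c t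
      rw [h c _ (by omega), h c _ (by omega), h c _ (by omega)] at h1
      simp only [Nat.succ_eq_add_one]
      omega
    · rw [Finset.filter_false_of_mem, Finset.filter_false_of_mem]
      · simp
      · rintro i - ⟨-, rfl⟩
        exact ht (hs' i)
      · rintro i - ⟨-, rfl⟩
        exact ht (hs i)
  refine ⟨Equiv.ofFiberEquiv (f := fun i => (μ i, s i)) (g := fun i => (μ' i, s' i))
    fun p => (Fintype.card_eq.1 (hcard p)).some, fun i => ?_⟩
  have := Equiv.ofFiberEquiv_map (f := fun i => (μ i, s i)) (g := fun i => (μ' i, s' i))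
    (fun p => (Fintype.card_eq.1 (hcard p)).some) i
  simpa using this

theorem IsJordanForm.of_equiv {n : ℕ} {A : Matrix (Fin n) (Fin n) ℂ} {r' : ℕ} {μ' : Fin r' → ℂ}
    {s' : Fin r' → ℕ} (h : IsJordanForm A μ s) (σ : Fin r ≃ Fin r')
    (hσ : ∀ i, μ' (σ i) = μ i ∧ s' (σ i) = s i) : IsJordanForm A μ' s' := by
  obtain ⟨hs, e, S, hA⟩ := h
  let τ : (Σ i, Fin (s i)) ≃ Σ i, Fin (s' i) :=
    Equiv.sigmaCongr σ fun i => finCongr (hσ i).2.symm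
  refine ⟨fun i => ?_, τ.symm.trans e, S, ?_⟩
  · have := hs (σ.symm i)
    rwa [← (hσ (σ.symm i)).2, σ.apply_symm_apply] at this
  · have hJ : jordanMatrix μ s = (jordanMatrix μ' s').submatrix τ τ := by
      ext x y
      simp only [Matrix.submatrix_apply, jordanMatrix_apply]
      have h1 : ∀ x : Σ i, Fin (s i), (τ x).1 = σ x.1 := fun _ => rfl
      have h2 : ∀ x : Σ i, Fin (s i), (τ x).2.val = x.2.val := fun _ => rfl
      simp only [h1, h2, (hσ _).1, σ.injective.eq_iff]
    rw [hA, hJ]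
    simp only [Matrix.reindex_apply, Matrix.submatrix_submatrix]
    rfl

/-- Matrices with the same Jordan form are similar. -/
theorem IsJordanForm.exists_similar {n : ℕ} {A B : Matrix (Fin n) (Fin n) ℂ}
    (hA : IsJordanForm A μ s) (hB : IsJordanForm B μ s) :
    ∃ G : GL (Fin n) ℂ, A * (G : Matrix (Fin n) (Fin n) ℂ) = G * B := by
  obtain ⟨_, e, S, rfl⟩ := hA
  obtain ⟨_, e', S', rfl⟩ := hB
  let π : Equiv.Perm (Fin n) := e.symm.trans e'
  have hdet : ((π.toPEquiv.toMatrix : Matrix (Fin n) (Fin n) ℂ)).det ≠ 0 := by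
    have := Matrix.det_permutation (R := ℂ) π
    rw [Equiv.Perm.permMatrix] at this
    rw [this]
    exact_mod_cast (Equiv.Perm.sign π).ne_zero
  let P := Matrix.GeneralLinearGroup.mkOfDetNeZero _ hdet
  have hP : Matrix.reindex e e (jordanMatrix μ s) * (P : Matrix (Fin n) (Fin n) ℂ) =
      P * Matrix.reindex e' e' (jordanMatrix μ s) := by
    have : (P : Matrix (Fin n) (Fin n) ℂ) = π.toPEquiv.toMatrix := rfl
    rw [this, PEquiv.toMatrix_toPEquiv_mul, PEquiv.mul_toMatrix_toPEquiv]
    ext i j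
    simp [π]
  refine ⟨S * P * S'⁻¹, ?_⟩
  simp only [Units.val_mul]
  have h1 : ((S⁻¹ : GL (Fin n) ℂ) : Matrix (Fin n) (Fin n) ℂ) * S = 1 := by simp
  have h2 : ((S'⁻¹ : GL (Fin n) ℂ) : Matrix (Fin n) (Fin n) ℂ) * S' = 1 := by simp
  calc _ = S * Matrix.reindex e e (jordanMatrix μ s) * (((S⁻¹ : GL (Fin n) ℂ) :
        Matrix (Fin n) (Fin n) ℂ) * S) * P * ((S'⁻¹ : GL (Fin n) ℂ) : Matrix (Fin n) (Fin n) ℂ) := by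
        noncomm_ring
    _ = S * (Matrix.reindex e e (jordanMatrix μ s) * P) *
        ((S'⁻¹ : GL (Fin n) ℂ) : Matrix (Fin n) (Fin n) ℂ) := by rw [h1]; noncomm_ring
    _ = S * P * (((S'⁻¹ : GL (Fin n) ℂ) : Matrix (Fin n) (Fin n) ℂ) * S') *
        Matrix.reindex e' e' (jordanMatrix μ s) *
        ((S'⁻¹ : GL (Fin n) ℂ) : Matrix (Fin n) (Fin n) ℂ) := by rw [hP, h2]; noncomm_ring
    _ = _ := by noncomm_ring

end JordanInvariants

/-! ### Matching the eigenvalues -/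

section Matching

open Filter Topology

variable {n : ℕ}

theorem rank_add_finrank_ker_toEuclideanCLM (M : Matrix (Fin n) (Fin n) ℂ) :
    M.rank + Module.finrank ℂ (LinearMap.ker
      ((Matrix.toEuclideanCLM (𝕜 := ℂ) M :
          EuclideanSpace ℂ (Fin n) →L[ℂ] EuclideanSpace ℂ (Fin n)) :
        EuclideanSpace ℂ (Fin n) →ₗ[ℂ] EuclideanSpace ℂ (Fin n))) = n := by
  rw [Matrix.coe_toEuclideanCLM_eq_toEuclideanLin, Matrix.toEuclideanLin, Matrix.toLpLin_eq_toLin,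
    Matrix.rank_eq_finrank_range_toLin M (PiLp.basisFun 2 ℂ (Fin n)) (PiLp.basisFun 2 ℂ (Fin n)),
    LinearMap.finrank_range_add_finrank_ker]
  simp

theorem exists_rank_le (M₀ : Matrix (Fin n) (Fin n) ℂ) :
    ∃ c : ℝ, 0 < c ∧ ∀ M : Matrix (Fin n) (Fin n) ℂ, ‖M - M₀‖ < c → M₀.rank ≤ M.rank := by
  obtain ⟨c, hc, h⟩ := exists_finrank_ker_le (Matrix.toEuclideanCLM (𝕜 := ℂ) M₀)
  refine ⟨c, hc, fun M hM => ?_⟩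
  have h1 := h (Matrix.toEuclideanCLM (𝕜 := ℂ) M)
    (by rwa [← map_sub, Matrix.l2_opNorm_toEuclideanCLM])
  have h2 := rank_add_finrank_ker_toEuclideanCLM M
  have h3 := rank_add_finrank_ker_toEuclideanCLM M₀
  omega

theorem eventually_rank_le (A₀ : Matrix (Fin n) (Fin n) ℂ) (c : ℂ) (k : ℕ) :
    ∀ᶠ δ in 𝓝[>] (0 : ℝ), ∀ (A : Matrix (Fin n) (Fin n) ℂ) (d : ℂ), ‖A - A₀‖ < δ → ‖d - c‖ < δ →
      ((A₀ - c • 1) ^ k).rank ≤ ((A - d • 1) ^ k).rank := by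
  obtain ⟨ε, hε, h⟩ := exists_rank_le ((A₀ - c • 1) ^ k)
  have hcont : Continuous fun p : Matrix (Fin n) (Fin n) ℂ × ℂ =>
      (p.1 - p.2 • (1 : Matrix (Fin n) (Fin n) ℂ)) ^ k := by fun_prop
  obtain ⟨δ₀, hδ₀, hd⟩ := Metric.continuousAt_iff.1 (hcont.continuousAt (x := (A₀, c))) ε hε
  filter_upwards [Ioo_mem_nhdsGT hδ₀] with δ hδ A d hA hdc
  refine h _ ?_
  have := @hd (A, d) ?_
  · rwa [dist_eq_norm] at this
  · rw [Prod.dist_eq, dist_eq_norm, dist_eq_norm]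
    exact max_lt (hA.trans hδ.2) (hdc.trans hδ.2)

theorem eventually_norm_det_lt (A₀ : Matrix (Fin n) (Fin n) ℂ) (c : ℂ)
    (h0 : (A₀ - c • 1).det = 0) {b : ℝ} (hb : 0 < b) :
    ∀ᶠ δ in 𝓝[>] (0 : ℝ), ∀ A : Matrix (Fin n) (Fin n) ℂ, ‖A - A₀‖ < δ →
      ‖(A - c • 1).det‖ < b := by
  have hcont : Continuous fun A : Matrix (Fin n) (Fin n) ℂ =>
      (A - c • (1 : Matrix (Fin n) (Fin n) ℂ)).det := by fun_prop
  obtain ⟨δ₀, hδ₀, hd⟩ := Metric.continuousAt_iff.1 (hcont.continuousAt (x := A₀)) b hb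
  filter_upwards [Ioo_mem_nhdsGT hδ₀] with δ hδ A hA
  have := @hd A (by rw [dist_eq_norm]; exact hA.trans hδ.2)
  rwa [dist_eq_norm, h0, sub_zero] at this

variable {A₀ : Matrix (Fin n) (Fin n) ℂ} {r : ℕ} {μ : Fin r → ℂ} {s : Fin r → ℕ}

/-- Matrices near `A₀` have an eigenvalue near each eigenvalue of `A₀`. -/
theorem IsJordanForm.eventually_exists_eigenvalue_near (h₀ : IsJordanForm A₀ μ s) {η : ℝ}
    (hη : 0 < η) {c : ℂ} (hc : c ∈ Finset.univ.image μ) :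
    ∀ᶠ δ in 𝓝[>] (0 : ℝ), ∀ A : Matrix (Fin n) (Fin n) ℂ, ‖A - A₀‖ < δ →
      ∀ (r' : ℕ) (μ' : Fin r' → ℂ) (s' : Fin r' → ℕ), IsJordanForm A μ' s' →
        ∃ c' ∈ Finset.univ.image μ', ‖c' - c‖ < η := by
  have h0 : (A₀ - c • 1).det = 0 := by
    obtain ⟨i, -, rfl⟩ := Finset.mem_image.1 hc
    rw [h₀.det_sub_smul_one]
    refine Finset.prod_eq_zero (Finset.mem_univ i) ?_
    rw [sub_self, zero_pow (h₀.1 i).ne']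
  filter_upwards [eventually_norm_det_lt A₀ c h0 (pow_pos hη n)] with δ hδ A hA r' μ' s' h'
  by_contra! hfar
  refine (hδ A hA).not_ge ?_
  rw [h'.det_sub_smul_one, norm_prod, ← h'.sum_sizes, ← Finset.prod_pow_eq_pow_sum]
  refine Finset.prod_le_prod (fun i _ => by positivity) fun i _ => ?_
  rw [norm_pow]
  exact pow_le_pow_left₀ hη.le (hfar _ (Finset.mem_image_of_mem _ (Finset.mem_univ i))) _

theorem exists_pos_lt_norm_sub (t : Finset ℂ) :
    ∃ g : ℝ, 0 < g ∧ ∀ c ∈ t, ∀ d ∈ t, c ≠ d → g ≤ ‖c - d‖ := by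
  have h : ∀ᶠ g in 𝓝[>] (0 : ℝ), ∀ c ∈ t, ∀ d ∈ t, c ≠ d → g ≤ ‖c - d‖ := by
    refine (Finset.eventually_all t).2 fun c _ => (Finset.eventually_all t).2 fun d _ => ?_
    by_cases hcd : c = d
    · simp [hcd]
    · filter_upwards [Ioo_mem_nhdsGT (norm_pos_iff.2 (sub_ne_zero.2 hcd))] with g hg _
      exact hg.2.le
  obtain ⟨g, hg, hg0⟩ := (h.and self_mem_nhdsWithin).exists
  exact ⟨g, hg0, hg⟩

/-- A matrix near `A₀` with the same Jordan structure arises, up to similarity, by moving each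
eigenvalue of `A₀` slightly while keeping all Jordan blocks.

Each eigenvalue of `A₀` has a nearby eigenvalue of `A`, and as both matrices have the same number
of eigenvalues, this is a bijection. The ranks of the powers `(A - c')^k` can only go up under
perturbation, while their total over all eigenvalues and all `k` depends on the Jordan structure
only; so none of them changes, and they determine the blocks. -/
theorem IsJordanForm.exists_eigenvalue_map (h₀ : IsJordanForm A₀ μ s) {η : ℝ} (hη : 0 < η) :
    ∃ ε : ℝ, 0 < ε ∧ ∀ A : Matrix (Fin n) (Fin n) ℂ, SameJordanStructure A A₀ → ‖A - A₀‖ < ε →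
      ∃ h : ℂ → ℂ, (∀ i, ‖h (μ i) - μ i‖ < η) ∧ IsJordanForm A (h ∘ μ) s := by
  set Λ := Finset.univ.image μ with hΛ
  obtain ⟨g, hg, hgap⟩ := exists_pos_lt_norm_sub Λ
  have hrank : ∀ᶠ δ in 𝓝[>] (0 : ℝ), ∀ c ∈ Λ, ∀ k ∈ Finset.range (n + 2),
      ∀ (A : Matrix (Fin n) (Fin n) ℂ) (d : ℂ), ‖A - A₀‖ < δ → ‖d - c‖ < δ →
        ((A₀ - c • 1) ^ k).rank ≤ ((A - d • 1) ^ k).rank :=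
    (Finset.eventually_all Λ).2 fun c _ => (Finset.eventually_all _).2 fun k _ =>
      eventually_rank_le A₀ c k
  obtain ⟨δ, hδrank, hδ⟩ := (hrank.and self_mem_nhdsWithin).exists
  have hδ0 : 0 < δ := hδ
  -- The bound `g / 2` keeps the eigenvalues of `A` near distinct eigenvalues of `A₀` apart.
  set η' := min (min δ η) (g / 2)
  have hη' : 0 < η' := by positivity
  have hnear := (Finset.eventually_all Λ).2 fun c hc => h₀.eventually_exists_eigenvalue_near hη' hc
  obtain ⟨ε, ⟨hε, hεδ⟩⟩ := (hnear.and (Ioo_mem_nhdsGT hδ0)).exists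
  refine ⟨ε, hεδ.1, fun A hA hAε => ?_⟩
  obtain ⟨Ω, ⟨r₁, μ₁, s₁, h₁, hΩ₁⟩, ⟨r', μ', s', h', hΩ'⟩⟩ := hA
  have hstr : blockStructure μ' s' = blockStructure μ₁ s₁ := hΩ'.trans hΩ₁.symm
  have hΛ₁ : Finset.univ.image μ₁ = Λ := h₁.image_eq h₀
  have hcard : (Finset.univ.image μ').card = Λ.card := by
    rw [card_image_eq_of_blockStructure_eq hstr, hΛ₁]
  have hsum := sum_kerDim_eq_of_blockStructure_eq hstr (n + 2)
  rw [hΛ₁, h₁.kerDim_eq h₀] at hsum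
  have hex : ∀ c : ℂ, ∃ c' : ℂ, c ∈ Λ → c' ∈ Finset.univ.image μ' ∧ ‖c' - c‖ < η' := by
    intro c
    by_cases hc : c ∈ Λ
    · obtain ⟨c', h1, h2⟩ := hε c hc A hAε r' μ' s' h'
      exact ⟨c', fun _ => ⟨h1, h2⟩⟩
    · exact ⟨0, fun h => absurd h hc⟩
  choose φ hφ using hex
  have hinj : Set.InjOn φ Λ := by
    intro c hc d hd hcd
    by_contra hne
    have h1 := hgap c hc d hd hne
    have h2 := (hφ c hc).2
    have h3 := (hφ d hd).2
    have h4 : ‖c - d‖ ≤ ‖φ d - d‖ + ‖φ c - c‖ := by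
      have : c - d = (φ d - d) - (φ c - c) := by rw [hcd]; ring
      rw [this]
      exact norm_sub_le _ _
    have h5 : η' ≤ g / 2 := min_le_right _ _
    linarith
  have himage : Λ.image φ = Finset.univ.image μ' := by
    refine Finset.eq_of_subset_of_card_le ?_ ?_
    · intro c' hc'
      obtain ⟨c, hc, rfl⟩ := Finset.mem_image.1 hc'
      exact (hφ c hc).1
    · rw [Finset.card_image_of_injOn hinj, hcard]
  have hmem : ∀ i, μ i ∈ Λ := fun i => Finset.mem_image_of_mem _ (Finset.mem_univ i)
  have hle : ∀ c ∈ Λ, ∀ k ∈ Finset.range (n + 2), kerDim μ' s' (φ c) k ≤ kerDim μ s c k := by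
    intro c hc k hk
    have h1 := h'.rank_sub_smul_one_pow (φ c) k
    have h2 := h₀.rank_sub_smul_one_pow c k
    have h3 := hδrank c hc k hk A (φ c) (hAε.trans hεδ.2)
      ((hφ c hc).2.trans_le ((min_le_left _ _).trans (min_le_left _ _)))
    omega
  have heq : ∀ c ∈ Λ, ∀ k ∈ Finset.range (n + 2), kerDim μ' s' (φ c) k = kerDim μ s c k := by
    rw [← himage, Finset.sum_image hinj] at hsum
    intro c hc
    have h1 := (Finset.sum_eq_sum_iff_of_le fun c hc => Finset.sum_le_sum (hle c hc)).1 hsum c hc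
    exact (Finset.sum_eq_sum_iff_of_le (hle c hc)).1 h1
  have hker : ∀ c', ∀ k ≤ n + 1, kerDim μ' s' c' k = kerDim (φ ∘ μ) s c' k := by
    intro c' k hk
    by_cases hc' : c' ∈ Λ.image φ
    · obtain ⟨c, hc, rfl⟩ := Finset.mem_image.1 hc'
      rw [heq c hc k (Finset.mem_range.2 (by omega)), kerDim, kerDim]
      congr 1
      ext i
      simp only [Finset.mem_filter, Finset.mem_univ, true_and, Function.comp_apply]
      exact ⟨fun h => by rw [h], fun h => hinj (hmem i) hc h⟩
    · have h1 : Finset.univ.filter (fun i => (φ ∘ μ) i = c') = ∅ := by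
        refine Finset.filter_false_of_mem ?_
        rintro i - rfl
        exact hc' (Finset.mem_image_of_mem _ (hmem i))
      have h2 : Finset.univ.filter (fun i => μ' i = c') = ∅ := by
        refine Finset.filter_false_of_mem ?_
        rintro i - rfl
        rw [himage] at hc'
        exact hc' (Finset.mem_image_of_mem _ (Finset.mem_univ i))
      rw [kerDim, kerDim, h1, h2, Finset.sum_empty, Finset.sum_empty]
  obtain ⟨σ, hσ⟩ := exists_equiv_of_kerDim_eq (m := n + 1)
    (fun i => ⟨h'.1 i, Nat.lt_succ_of_le (h'.size_le i)⟩)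
    (fun i => ⟨h₀.1 i, Nat.lt_succ_of_le (h₀.size_le i)⟩) hker
  exact ⟨φ, fun i => (hφ _ (hmem i)).2.trans_le ((min_le_left _ _).trans (min_le_right _ _)),
    h'.of_equiv σ hσ⟩

end Matching

/-! ### Shifting eigenvalues by a polynomial -/

section Shift

open Polynomial

variable {n r : ℕ} {μ : Fin r → ℂ} {s : Fin r → ℕ}

/-- The matrix that acts on the span of the `i`-th Jordan chain as the scalar `g i`, where the
Jordan chains are given by the columns of `S`, numbered through `e`. Adding it to a matrix with
these Jordan chains moves the eigenvalues by `g`. -/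
noncomputable def chainScalar (e : (Σ i, Fin (s i)) ≃ Fin n) (S : GL (Fin n) ℂ) :
    (Fin r → ℂ) →ₗ[ℂ] Matrix (Fin n) (Fin n) ℂ where
  toFun g := (S : Matrix (Fin n) (Fin n) ℂ) * Matrix.diagonal (fun k => g (e.symm k).1) *
    ((S⁻¹ : GL (Fin n) ℂ) : Matrix (Fin n) (Fin n) ℂ)
  map_add' f g := by
    rw [← add_mul, ← mul_add, Matrix.diagonal_add]; rfl
  map_smul' c g := by
    rw [RingHom.id_apply, ← Matrix.smul_mul, ← Matrix.mul_smul, ← Matrix.diagonal_smul]; rfl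

variable (e : (Σ i, Fin (s i)) ≃ Fin n) (S : GL (Fin n) ℂ)

theorem chainScalar_apply (g : Fin r → ℂ) : chainScalar e S g =
    (S : Matrix (Fin n) (Fin n) ℂ) * Matrix.diagonal (fun k => g (e.symm k).1) *
    ((S⁻¹ : GL (Fin n) ℂ) : Matrix (Fin n) (Fin n) ℂ) := rfl

theorem units_conj_mul_units_conj (S : GL (Fin n) ℂ) (M N : Matrix (Fin n) (Fin n) ℂ) :
    ((S : Matrix (Fin n) (Fin n) ℂ) * M * ((S⁻¹ : GL (Fin n) ℂ) : Matrix (Fin n) (Fin n) ℂ)) *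
      ((S : Matrix (Fin n) (Fin n) ℂ) * N * ((S⁻¹ : GL (Fin n) ℂ) : Matrix (Fin n) (Fin n) ℂ)) =
    (S : Matrix (Fin n) (Fin n) ℂ) * (M * N) *
      ((S⁻¹ : GL (Fin n) ℂ) : Matrix (Fin n) (Fin n) ℂ) := by
  simp only [mul_assoc, Units.inv_mul_cancel_left]

theorem reindex_diagonal (g : Fin r → ℂ) :
    Matrix.diagonal (fun k => g (e.symm k).1) =
      Matrix.reindex e e (Matrix.diagonal fun x : Σ i, Fin (s i) => g x.1) := by
  rw [Matrix.reindex_apply, Matrix.submatrix_diagonal_equiv]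
  rfl

theorem trace_chainScalar_single_mul (i : Fin r) (g : Fin r → ℂ) :
    (chainScalar e S (Pi.single i 1) * chainScalar e S g).trace = s i * g i := by
  rw [chainScalar_apply, chainScalar_apply, units_conj_mul_units_conj, Matrix.trace_units_conj,
    Matrix.diagonal_mul_diagonal, Matrix.trace_diagonal, ← Equiv.sum_comp e, Fintype.sum_sigma,
    Finset.sum_eq_single i]
  · simp
  · intro j _ hj
    simp [hj]
  · simp

variable {A₀ : Matrix (Fin n) (Fin n) ℂ}

theorem isJordanForm_add_chainScalar (hs : ∀ i, 0 < s i)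
    (hA : A₀ = (S : Matrix (Fin n) (Fin n) ℂ) * Matrix.reindex e e (jordanMatrix μ s) *
      ((S⁻¹ : GL (Fin n) ℂ) : Matrix (Fin n) (Fin n) ℂ)) (g : Fin r → ℂ) :
    IsJordanForm (A₀ + chainScalar e S g) (μ + g) s := by
  refine ⟨hs, e, S, ?_⟩
  rw [hA, chainScalar_apply, ← add_mul, ← mul_add, reindex_diagonal,
    ← jordanMatrix_add_diagonal]
  rfl

theorem commute_chainScalar
    (hA : A₀ = (S : Matrix (Fin n) (Fin n) ℂ) * Matrix.reindex e e (jordanMatrix μ s) *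
      ((S⁻¹ : GL (Fin n) ℂ) : Matrix (Fin n) (Fin n) ℂ)) (g : Fin r → ℂ) :
    A₀ * chainScalar e S g = chainScalar e S g * A₀ := by
  have key : jordanMatrix μ s * Matrix.diagonal (fun x => g x.1) =
      Matrix.diagonal (fun x => g x.1) * jordanMatrix μ s := by
    ext x y
    rw [Matrix.mul_diagonal, Matrix.diagonal_mul, jordanMatrix_apply]
    by_cases h : x.1 = y.1
    · rw [congrArg g h, mul_comm]
    · simp [h]
  rw [hA, chainScalar_apply, units_conj_mul_units_conj, units_conj_mul_units_conj,
    reindex_diagonal]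
  have h2 := congrArg (Matrix.reindexAlgEquiv ℂ ℂ e) key
  rw [map_mul, map_mul] at h2
  rw [← Matrix.coe_reindexAlgEquiv ℂ ℂ, h2]

theorem aeval_units_conj (S : GL (Fin n) ℂ) (M : Matrix (Fin n) (Fin n) ℂ) (p : ℂ[X]) :
    aeval ((S : Matrix (Fin n) (Fin n) ℂ) * M *
        ((S⁻¹ : GL (Fin n) ℂ) : Matrix (Fin n) (Fin n) ℂ)) p =
      (S : Matrix (Fin n) (Fin n) ℂ) * aeval M p *
        ((S⁻¹ : GL (Fin n) ℂ) : Matrix (Fin n) (Fin n) ℂ) := by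
  simp only [aeval_eq_sum_range, Finset.mul_sum, Finset.sum_mul]
  refine Finset.sum_congr rfl fun k _ => ?_
  rw [Units.conj_pow, Matrix.mul_smul, Matrix.smul_mul]

theorem aeval_jordanBlock (c : ℂ) (k m : ℕ) (hkm : k ≤ m) (p : ℂ[X]) (a : ℂ)
    (hp : (X - C c) ^ m ∣ p - C a) : aeval (jordanBlock c k) p = a • 1 := by
  have htri : (jordanBlock c k).IsUpperTriangular := by
    intro i j hij
    have h : j.val < i.val := hij
    rw [jordanBlock, Matrix.of_apply, if_neg (by rintro rfl; omega), if_neg (by omega)]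
  have hchar : (jordanBlock c k).charpoly = (X - C c) ^ k := by
    rw [Matrix.charpoly_of_isUpperTriangular _ htri]
    simp [jordanBlock]
  obtain ⟨q, hq⟩ := ((hchar ▸ pow_dvd_pow _ hkm).trans hp :
    (jordanBlock c k).charpoly ∣ p - C a)
  have h2 := congrArg (aeval (jordanBlock c k)) hq
  rw [map_mul, Matrix.aeval_self_charpoly, zero_mul, map_sub, aeval_C, sub_eq_zero] at h2
  rw [h2, Algebra.algebraMap_eq_smul_one]

theorem aeval_blockDiagonal' (M : ∀ i, Matrix (Fin (s i)) (Fin (s i)) ℂ) (p : ℂ[X]) :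
    aeval (Matrix.blockDiagonal' M) p = Matrix.blockDiagonal' fun i => aeval (M i) p := by
  induction p using Polynomial.induction_on' with
  | add p q hp hq =>
    rw [map_add, hp, hq, ← Matrix.blockDiagonal'_add]
    congr 1
    ext1 i
    simp
  | monomial k a =>
    simp only [aeval_monomial, ← Algebra.smul_def]
    rw [← Matrix.blockDiagonal'_pow, ← Matrix.blockDiagonal'_smul]
    rfl

/-- The polynomial solves the congruences `p ≡ h c` modulo `(X - c)^n` for all eigenvalues `c`. -/
theorem exists_aeval_eq_chainScalar
    (hA : A₀ = (S : Matrix (Fin n) (Fin n) ℂ) * Matrix.reindex e e (jordanMatrix μ s) *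
      ((S⁻¹ : GL (Fin n) ℂ) : Matrix (Fin n) (Fin n) ℂ)) (h : ℂ → ℂ) :
    ∃ p : ℂ[X], aeval A₀ p = chainScalar e S (h ∘ μ) := by
  have hcop : Pairwise (Function.onFun IsCoprime
      fun c : (Finset.univ.image μ : Finset ℂ) => Ideal.span {(X - C (c : ℂ)) ^ n}) := by
    intro c d hcd
    simp only [Function.onFun]
    rw [Ideal.isCoprime_span_singleton_iff]
    exact (pairwise_coprime_X_sub_C Subtype.val_injective hcd).pow
  obtain ⟨p, hp⟩ := Ideal.exists_forall_sub_mem_ideal hcop fun c => C (h c)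
  have hsz : ∀ i, s i ≤ n := by
    intro i
    have := Fintype.card_congr e
    rw [Fintype.card_sigma, Fintype.card_fin] at this
    rw [← this]
    simp only [Fintype.card_fin]
    exact Finset.single_le_sum (f := s) (fun _ _ => Nat.zero_le _) (Finset.mem_univ i)
  refine ⟨p, ?_⟩
  have hJ : aeval (jordanMatrix μ s) p = Matrix.diagonal fun x => (h ∘ μ) x.1 := by
    rw [jordanMatrix, aeval_blockDiagonal']
    have : (fun i => aeval (jordanBlock (μ i) (s i)) p) =
        fun i => Matrix.diagonal fun _ => h (μ i) := by
      ext1 i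
      rw [aeval_jordanBlock (μ i) (s i) n (hsz i) p (h (μ i)), Matrix.smul_one_eq_diagonal]
      exact Ideal.mem_span_singleton.1
        (hp ⟨μ i, Finset.mem_image_of_mem _ (Finset.mem_univ i)⟩)
    rw [this, Matrix.blockDiagonal'_diagonal]
    rfl
  rw [hA, aeval_units_conj, chainScalar_apply, reindex_diagonal, ← hJ, ← Matrix.coe_reindexAlgEquiv ℂ ℂ,
    aeval_algEquiv]
  rfl

end Shift

/-! ### Lipschitz similarity -/

section Similarity

open Polynomial

variable {n : ℕ}

/-- The operator `X ↦ A X - X B`, whose kernel consists of the intertwiners of `A` and `B`. -/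
noncomputable def sylvester (A B : Matrix (Fin n) (Fin n) ℂ) :
    Matrix (Fin n) (Fin n) ℂ →L[ℂ] Matrix (Fin n) (Fin n) ℂ :=
  ContinuousLinearMap.mul ℂ (Matrix (Fin n) (Fin n) ℂ) A -
    (ContinuousLinearMap.mul ℂ (Matrix (Fin n) (Fin n) ℂ)).flip B

theorem sylvester_apply (A B X : Matrix (Fin n) (Fin n) ℂ) :
    sylvester A B X = A * X - X * B := rfl

theorem norm_sylvester_sub_le (A B A' B' : Matrix (Fin n) (Fin n) ℂ) :
    ‖sylvester A B - sylvester A' B'‖ ≤ ‖A - A'‖ + ‖B - B'‖ := by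
  have h : sylvester A B - sylvester A' B' = sylvester (A - A') (B - B') := by
    ext1 X
    simp only [sub_apply, sylvester_apply]
    noncomm_ring
  rw [h]
  refine (norm_sub_le _ _).trans (add_le_add ?_ ?_)
  · exact ContinuousLinearMap.opNorm_mul_apply_le ℂ _ _
  · refine ContinuousLinearMap.opNorm_le_bound _ (norm_nonneg _) fun X => ?_
    rw [mul_comm]
    exact norm_mul_le X (B - B')

/-- If `A` is similar to a polynomial in `A₀`, then left multiplication by the similarity embeds
the commutant of `A₀` into the intertwiners. -/
theorem finrank_ker_sylvester_le {A A₀ : Matrix (Fin n) (Fin n) ℂ} (q : ℂ[X]) (G : GL (Fin n) ℂ)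
    (hG : A * (G : Matrix (Fin n) (Fin n) ℂ) = G * aeval A₀ q) :
    Module.finrank ℂ (LinearMap.ker (sylvester A₀ A₀ :
        Matrix (Fin n) (Fin n) ℂ →ₗ[ℂ] Matrix (Fin n) (Fin n) ℂ)) ≤
      Module.finrank ℂ (LinearMap.ker (sylvester A (aeval A₀ q) :
        Matrix (Fin n) (Fin n) ℂ →ₗ[ℂ] Matrix (Fin n) (Fin n) ℂ)) := by
  have hmap : ∀ X ∈ LinearMap.ker (sylvester A₀ A₀ :
        Matrix (Fin n) (Fin n) ℂ →ₗ[ℂ] Matrix (Fin n) (Fin n) ℂ),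
      LinearMap.mulLeft ℂ (G : Matrix (Fin n) (Fin n) ℂ) X ∈
        LinearMap.ker (sylvester A (aeval A₀ q) :
          Matrix (Fin n) (Fin n) ℂ →ₗ[ℂ] Matrix (Fin n) (Fin n) ℂ) := by
    intro X hX
    have hX' : A₀ * X - X * A₀ = 0 := hX
    have hcomm : Commute A₀ X := sub_eq_zero.1 hX'
    have hcomm' : aeval A₀ q * X = X * aeval A₀ q := by
      have : ∀ p : ℂ[X], Commute (aeval A₀ p) X := by
        intro p
        rw [aeval_eq_sum_range]
        exact Commute.sum_left _ _ _ fun k _ => (hcomm.pow_left k).smul_left _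
      exact this q
    change A * (G * X) - G * X * aeval A₀ q = 0
    rw [← mul_assoc, hG, mul_assoc, hcomm', mul_assoc, sub_self]
  refine LinearMap.finrank_le_finrank_of_injective
    (f := (LinearMap.mulLeft ℂ (G : Matrix (Fin n) (Fin n) ℂ)).restrict hmap) ?_
  intro X Y hXY
  have h1 : (G : Matrix (Fin n) (Fin n) ℂ) * X = G * Y := congrArg Subtype.val hXY
  exact Subtype.ext ((Units.mul_right_inj G).1 h1)

theorem norm_trace_le (M : Matrix (Fin n) (Fin n) ℂ) : ‖M.trace‖ ≤ n * ‖M‖ := by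
  refine (norm_sum_le _ _).trans ?_
  refine (Finset.sum_le_sum fun i _ => norm_entry_le M i i).trans ?_
  simp

theorem norm_trace_mul_mul_le {X Y Z : Matrix (Fin n) (Fin n) ℂ} {a b c : ℝ} (hX : ‖X‖ ≤ a)
    (hY : ‖Y‖ ≤ b) (hZ : ‖Z‖ ≤ c) : ‖(X * Y * Z).trace‖ ≤ n * (a * b * c) := by
  refine (norm_trace_le _).trans (mul_le_mul_of_nonneg_left ?_ (Nat.cast_nonneg n))
  have ha := (norm_nonneg X).trans hX
  have hb := (norm_nonneg Y).trans hY
  exact norm_mul_le_of_le (norm_mul_le_of_le hX hY) hZ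

theorem trace_mul_mul_eq {A₀ A X P D : Matrix (Fin n) (Fin n) ℂ} (hP : A₀ * P = P * A₀)
    (hX : A * X = X * (A₀ + D)) : (P * X * D).trace = (P * (A - A₀) * X).trace := by
  have h1 : (P * X * A₀).trace = (P * A₀ * X).trace := by
    rw [Matrix.trace_mul_comm, ← mul_assoc, hP]
  have h2 : P * (A - A₀) * X = P * X * A₀ + P * X * D - P * A₀ * X := by
    have : P * (A - A₀) * X = P * (A * X) - P * A₀ * X := by noncomm_ring
    rw [this, hX]
    noncomm_ring
  rw [h2, Matrix.trace_sub, Matrix.trace_add, h1]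
  ring

/-- The eigenvalue shift `g` is recovered from `A Y = Y (A₀ + D g)` by taking traces against the
matrices `D (Pi.single i 1)`, which commute with `A₀`. -/
theorem norm_eigenvalue_shift_le {r : ℕ} {μ : Fin r → ℂ} {s : Fin r → ℕ}
    {A A₀ Y : Matrix (Fin n) (Fin n) ℂ} (e : (Σ i, Fin (s i)) ≃ Fin n) (S : GL (Fin n) ℂ)
    (hs : ∀ i, 0 < s i)
    (hA₀ : A₀ = (S : Matrix (Fin n) (Fin n) ℂ) * Matrix.reindex e e (jordanMatrix μ s) *
      ((S⁻¹ : GL (Fin n) ℂ) : Matrix (Fin n) (Fin n) ℂ))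
    {M κ b : ℝ} (hM : 0 < M) (hMbound : ∀ g, ‖chainScalar e S g‖ ≤ M * ‖g‖)
    (hκ : n * M * M * κ ≤ 1 / 2) {g : Fin r → ℂ} (hY : A * Y = Y * (A₀ + chainScalar e S g))
    (hYκ : ‖Y - 1‖ ≤ κ) (hYb : ‖Y‖ ≤ b) : ‖g‖ ≤ 2 * (n * M * b) * ‖A - A₀‖ := by
  have hb : 0 ≤ b := (norm_nonneg Y).trans hYb
  have hgi : ∀ i, ‖g i‖ ≤ n * M * b * ‖A - A₀‖ + ‖g‖ / 2 := by
    intro i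
    have hP : ‖chainScalar e S (Pi.single i 1)‖ ≤ M := by
      have h1 := hMbound (Pi.single i 1)
      rwa [Pi.norm_single, norm_one, mul_one] at h1
    have htr : (s i : ℂ) * g i = (chainScalar e S (Pi.single i 1) * (A - A₀) * Y).trace -
        (chainScalar e S (Pi.single i 1) * (Y - 1) * chainScalar e S g).trace := by
      rw [← trace_mul_mul_eq (commute_chainScalar e S hA₀ _) hY,
        ← trace_chainScalar_single_mul e S, ← Matrix.trace_sub, mul_sub, sub_mul, mul_one,
        sub_sub_cancel]
    have h1 : ‖g i‖ ≤ ‖(s i : ℂ) * g i‖ := by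
      rw [norm_mul, Complex.norm_natCast]
      have : (1 : ℝ) ≤ s i := by exact_mod_cast hs i
      exact le_mul_of_one_le_left (norm_nonneg _) this
    rw [htr] at h1
    have h2 := h1.trans (norm_sub_le _ _)
    have h3 := norm_trace_mul_mul_le hP (le_refl ‖A - A₀‖) hYb
    have h4 := norm_trace_mul_mul_le hP hYκ (hMbound g)
    have h5 := mul_le_mul_of_nonneg_right hκ (norm_nonneg g)
    linarith
  have := (pi_norm_le_iff_of_nonneg (by positivity)).2 hgi
  linarith

/-- A matrix `A` near `A₀` with the same Jordan structure is similar to a polynomial in `A₀`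
through a matrix within `O(‖A - A₀‖)` of `1`.

The polynomial `A₀ + D g` is `A₀` with its eigenvalues moved by `g`. The intertwiners of `A` and
`A₀ + D g` are near the commutant of `A₀`, which gives `X` within `O(‖A - A₀‖ + ‖g‖)` of `1`. Taking
traces of `A X = X (A₀ + D g)` against matrices commuting with `A₀` then yields
`‖g‖ = O(‖A - A₀‖ + ‖X - 1‖ ‖g‖)`, where the last term can be absorbed. -/
theorem exists_intertwiner_lipschitz {r : ℕ} {μ : Fin r → ℂ} {s : Fin r → ℕ}
    {A₀ : Matrix (Fin n) (Fin n) ℂ} (h₀ : IsJordanForm A₀ μ s) :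
    ∃ K ε : ℝ, 0 < K ∧ 0 < ε ∧ ∀ A : Matrix (Fin n) (Fin n) ℂ, SameJordanStructure A A₀ →
      ‖A - A₀‖ < ε → ∃ (X : Matrix (Fin n) (Fin n) ℂ) (q : ℂ[X]),
        A * X = X * aeval A₀ q ∧ ‖X - 1‖ ≤ K * ‖A - A₀‖ := by
  obtain ⟨hs, e, S, hA₀⟩ := id h₀
  obtain ⟨C, c, hC, hc, hker⟩ := exists_ker_lipschitz (sylvester A₀ A₀)
  obtain ⟨M, hM, hMbound⟩ : ∃ M : ℝ, 0 < M ∧ ∀ g, ‖chainScalar e S g‖ ≤ M * ‖g‖ := by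
    refine ⟨‖LinearMap.toContinuousLinearMap (chainScalar e S)‖ + 1, by positivity, fun g => ?_⟩
    refine ((LinearMap.toContinuousLinearMap (chainScalar e S)).le_opNorm g).trans ?_
    gcongr
    linarith
  set C₁ := ‖(1 : Matrix (Fin n) (Fin n) ℂ)‖
  have hC₁ : 0 ≤ C₁ := norm_nonneg _
  -- `κ` bounds `‖Y - 1‖` so that `‖Y‖` is bounded and the term `‖Y - 1‖ ‖g‖` can be absorbed; `τ`
  -- bounds `‖A - A₀‖ + M ‖g‖` so that the kernel estimate applies and yields `‖Y - 1‖ ≤ κ`.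
  set κ : ℝ := min 1 (1 / (2 * (n * M * M + 1)))
  have hκ : 0 < κ := by positivity
  have hκ1 : κ ≤ 1 := min_le_left _ _
  have hκ2 : n * M * M * κ ≤ 1 / 2 := by
    have h1 : κ ≤ 1 / (2 * (n * M * M + 1)) := min_le_right _ _
    have h2 : n * M * M * κ ≤ n * M * M * (1 / (2 * (n * M * M + 1))) := by gcongr
    refine h2.trans ?_
    rw [mul_one_div, div_le_div_iff₀ (by positivity) (by norm_num)]
    linarith
  set τ : ℝ := min c (κ / (C * C₁ + 1))
  have hτ : 0 < τ := by positivity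
  have hτκ : C * τ * C₁ ≤ κ := by
    have h1 : τ ≤ κ / (C * C₁ + 1) := min_le_right _ _
    rw [le_div_iff₀ (by positivity)] at h1
    nlinarith
  obtain ⟨ε, hε, hmatch⟩ := h₀.exists_eigenvalue_map (η := τ / (2 * M)) (by positivity)
  refine ⟨C * (1 + M * (2 * (n * M * (C₁ + 1)))) * C₁ + 1, min ε (τ / 2), by positivity,
    by positivity, fun A hA hAε => ?_⟩
  obtain ⟨h, hclose, hJ⟩ := hmatch A hA (hAε.trans_le (min_le_left _ _))
  set E := ‖A - A₀‖
  have hE : E < τ / 2 := hAε.trans_le (min_le_right _ _)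
  have hE0 : 0 ≤ E := norm_nonneg _
  set g : Fin r → ℂ := (fun c => h c - c) ∘ μ
  have hg : ‖g‖ < τ / (2 * M) := (pi_norm_lt_iff (by positivity)).2 hclose
  have hgM : M * ‖g‖ < τ / 2 := by
    rw [lt_div_iff₀ (by positivity)] at hg
    linarith
  set D := chainScalar e S g
  have hD : ‖D‖ ≤ M * ‖g‖ := hMbound g
  obtain ⟨p, hp⟩ := exists_aeval_eq_chainScalar e S hA₀ fun c => h c - c
  have hq : aeval A₀ (X + p) = A₀ + D := by rw [map_add, aeval_X, hp]
  have hB : IsJordanForm (A₀ + D) (h ∘ μ) s := by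
    have h1 := isJordanForm_add_chainScalar e S hs hA₀ g
    have h2 : μ + g = h ∘ μ := by ext i; simp [g]
    rwa [h2] at h1
  obtain ⟨G, hG⟩ := hJ.exists_similar hB
  have hdim := finrank_ker_sylvester_le (X + p) G (by rw [hq]; exact hG)
  have hL : ‖sylvester A (A₀ + D) - sylvester A₀ A₀‖ ≤ E + M * ‖g‖ := by
    refine (norm_sylvester_sub_le _ _ _ _).trans ?_
    rw [add_sub_cancel_left]
    exact add_le_add le_rfl hD
  rw [hq] at hdim
  have hτc : τ ≤ c := min_le_left _ _
  obtain ⟨Y, hY0, hY1⟩ := hker _ (by linarith) hdim 1 (by simp [sylvester_apply])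
  have hYeq : A * Y = Y * (A₀ + D) := sub_eq_zero.1 hY0
  have hY2 : ‖Y - 1‖ ≤ C * (E + M * ‖g‖) * C₁ := hY1.trans (by gcongr)
  have hYκ : ‖Y - 1‖ ≤ κ := by
    refine hY2.trans (le_trans ?_ hτκ)
    gcongr
    linarith
  have hYn : ‖Y‖ ≤ C₁ + 1 := by
    have : Y = 1 + (Y - 1) := by abel
    rw [this]
    refine (norm_add_le _ _).trans ?_
    linarith
  have hgE : ‖g‖ ≤ 2 * (n * M * (C₁ + 1)) * E :=
    norm_eigenvalue_shift_le e S hs hA₀ hM hMbound hκ2 hYeq hYκ hYn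
  refine ⟨Y, X + p, by rw [hq]; exact hYeq, hY2.trans ?_⟩
  have h6 : C * (E + M * ‖g‖) * C₁ ≤ C * (E + M * (2 * (n * M * (C₁ + 1)) * E)) * C₁ := by
    gcongr
  linarith

end Similarity

/-! ### Schur factorizations -/

/-- Triangularity passes from `T₀` to the same polynomial in `A₀`. -/
theorem IsSchurFactorization.blockTriangular_aeval {n : ℕ} {A₀ U₀ T₀ : Matrix (Fin n) (Fin n) ℂ}
    (h : IsSchurFactorization A₀ U₀ T₀) (q : Polynomial ℂ) :
    (U₀ᴴ * Polynomial.aeval A₀ q * U₀).BlockTriangular id := by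
  obtain ⟨hU, hT, hA⟩ := h
  have hU1 : U₀ᴴ * U₀ = 1 := Matrix.mem_unitaryGroup_iff'.1 hU
  have hU2 : U₀ * U₀ᴴ = 1 := Matrix.mem_unitaryGroup_iff.1 hU
  let V : GL (Fin n) ℂ := ⟨U₀, U₀ᴴ, hU2, hU1⟩
  have h1 : Polynomial.aeval A₀ q = U₀ * Polynomial.aeval T₀ q * U₀ᴴ := by
    rw [hA]
    exact aeval_units_conj V T₀ q
  have h2 : U₀ᴴ * (U₀ * Polynomial.aeval T₀ q * U₀ᴴ) * U₀ =
      (U₀ᴴ * U₀) * Polynomial.aeval T₀ q * (U₀ᴴ * U₀) := by noncomm_ring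
  rw [h1, h2, hU1, Matrix.one_mul, Matrix.mul_one]
  have hT' : T₀ ∈ Matrix.blockTriangularSubalgebra ℂ ℂ (id : Fin n → Fin n) :=
    fun i j hij => hT i j hij
  rw [Polynomial.aeval_eq_sum_range]
  have := sum_mem (S := Matrix.blockTriangularSubalgebra ℂ ℂ (id : Fin n → Fin n))
    fun k (_ : k ∈ Finset.range (q.natDegree + 1)) =>
      Subalgebra.smul_mem _ (pow_mem hT' k) (q.coeff k)
  exact this

theorem norm_conjTranspose_mul_mul_sub_le {n : ℕ} {A A₀ U U₀ : Matrix (Fin n) (Fin n) ℂ}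
    (hU : U ∈ Matrix.unitaryGroup (Fin n) ℂ) (hU₀ : U₀ ∈ Matrix.unitaryGroup (Fin n) ℂ) :
    ‖Uᴴ * A * U - U₀ᴴ * A₀ * U₀‖ ≤ ‖A - A₀‖ + 2 * ‖A₀‖ * ‖U - U₀‖ := by
  have hU' : Uᴴ ∈ Matrix.unitaryGroup (Fin n) ℂ := Unitary.star_mem hU
  have h : Uᴴ * A * U - U₀ᴴ * A₀ * U₀ =
      Uᴴ * (A - A₀) * U + (Uᴴ * (A₀ * (U - U₀)) + (U - U₀)ᴴ * A₀ * U₀) := by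
    rw [Matrix.conjTranspose_sub]
    noncomm_ring
  rw [h]
  refine (norm_add_le _ _).trans (add_le_add ?_ ((norm_add_le _ _).trans ?_))
  · rw [CStarRing.norm_mul_mem_unitary _ hU, CStarRing.norm_mem_unitary_mul _ hU']
  · rw [CStarRing.norm_mul_mem_unitary _ hU₀, CStarRing.norm_mem_unitary_mul _ hU']
    have h1 := norm_mul_le A₀ (U - U₀)
    have h2 := norm_mul_le (U - U₀)ᴴ A₀
    rw [Matrix.l2_opNorm_conjTranspose] at h2
    linarith

end SchurStability

theorem theorem1p3 (n : ℕ) (A₀ : Matrix (Fin n) (Fin n) ℂ) :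
    ∃ K ε : ℝ, 0 < K ∧ 0 < ε ∧
      ∀ U₀ T₀ : Matrix (Fin n) (Fin n) ℂ, SchurStability.IsSchurFactorization A₀ U₀ T₀ →
        ∀ A : Matrix (Fin n) (Fin n) ℂ, SchurStability.SameJordanStructure A A₀ →
          ‖A - A₀‖ < ε →
            ∃ U T : Matrix (Fin n) (Fin n) ℂ, SchurStability.IsSchurFactorization A U T ∧
              ‖U - U₀‖ + ‖T - T₀‖ ≤ K * ‖A - A₀‖ := by
  open SchurStability in
  by_cases hJ : ∃ (r : ℕ) (μ : Fin r → ℂ) (s : Fin r → ℕ), IsJordanForm A₀ μ s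
  swap
  · -- `SameJordanStructure A A₀` includes a Jordan form of `A₀`.
    refine ⟨1, 1, one_pos, one_pos, fun _ _ _ A hA _ => ?_⟩
    obtain ⟨Ω, ⟨r, μ, s, h, -⟩, -⟩ := hA
    exact absurd ⟨r, μ, s, h⟩ hJ
  obtain ⟨r, μ, s, h₀⟩ := hJ
  obtain ⟨K, ε, hK, hε, hX⟩ := exists_intertwiner_lipschitz h₀
  obtain ⟨C, ρ, hC, hρ, hqr⟩ := exists_qr_lipschitz n
  refine ⟨1 + (1 + 2 * ‖A₀‖) * (C * K), min ε (ρ / K), by positivity, by positivity,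
    fun U₀ T₀ hUT A hA hAε => ?_⟩
  obtain ⟨X, q, hAX, hX1⟩ := hX A hA (hAε.trans_le (min_le_left _ _))
  have htri := hUT.blockTriangular_aeval q
  obtain ⟨hU, hT, hA₀⟩ := hUT
  have hU1 : U₀ᴴ * U₀ = 1 := Matrix.mem_unitaryGroup_iff'.1 hU
  have hU2 : U₀ * U₀ᴴ = 1 := Matrix.mem_unitaryGroup_iff.1 hU
  have hU' : U₀ᴴ ∈ Matrix.unitaryGroup (Fin n) ℂ := Unitary.star_mem hU
  have hW1 : ‖U₀ᴴ * X * U₀ - 1‖ = ‖X - 1‖ := by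
    have : U₀ᴴ * X * U₀ - 1 = U₀ᴴ * (X - 1) * U₀ := by
      rw [mul_sub, sub_mul, mul_one, hU1]
    rw [this, CStarRing.norm_mul_mem_unitary _ hU, CStarRing.norm_mem_unitary_mul _ hU']
  have hW2 : ‖U₀ᴴ * X * U₀ - 1‖ < ρ := by
    rw [hW1]
    have h1 : ‖A - A₀‖ < ρ / K := hAε.trans_le (min_le_right _ _)
    rw [lt_div_iff₀ hK] at h1
    linarith
  obtain ⟨Q, R, hQ, hR, hRu, hQR, hQ1⟩ := hqr _ hW2
  have hQQ : Qᴴ * Q = 1 := Matrix.mem_unitaryGroup_iff'.1 hQ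
  have hUQ : U₀ * Q ∈ Matrix.unitaryGroup (Fin n) ℂ := mul_mem hU hQ
  have hUQ2 : (U₀ * Q) * (U₀ * Q)ᴴ = 1 := Matrix.mem_unitaryGroup_iff.1 hUQ
  have hRdet := (Matrix.isUnit_iff_isUnit_det R).1 hRu
  have hT₀ : T₀ = U₀ᴴ * A₀ * U₀ := by
    have : U₀ᴴ * (U₀ * T₀ * U₀ᴴ) * U₀ = (U₀ᴴ * U₀) * T₀ * (U₀ᴴ * U₀) := by noncomm_ring
    rw [hA₀, this, hU1, Matrix.one_mul, Matrix.mul_one]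
  -- In the new basis `A` becomes `R` conjugating the triangular matrix `U₀ᴴ q(A₀) U₀`.
  have hTR : (U₀ * Q)ᴴ * A * (U₀ * Q) = R * (U₀ᴴ * Polynomial.aeval A₀ q * U₀) * R⁻¹ := by
    have h1 : (U₀ * Q)ᴴ * A * (U₀ * Q) * R = R * (U₀ᴴ * Polynomial.aeval A₀ q * U₀) := by
      calc (U₀ * Q)ᴴ * A * (U₀ * Q) * R = Qᴴ * U₀ᴴ * A * U₀ * (Q * R) := by
            rw [Matrix.conjTranspose_mul]; noncomm_ring
        _ = Qᴴ * U₀ᴴ * A * (U₀ * U₀ᴴ) * X * U₀ := by rw [← hQR]; noncomm_ring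
        _ = Qᴴ * U₀ᴴ * (A * X) * U₀ := by rw [hU2]; noncomm_ring
        _ = Qᴴ * U₀ᴴ * X * (U₀ * U₀ᴴ) * Polynomial.aeval A₀ q * U₀ := by
            rw [hAX, hU2]; noncomm_ring
        _ = Qᴴ * (U₀ᴴ * X * U₀) * (U₀ᴴ * Polynomial.aeval A₀ q * U₀) := by noncomm_ring
        _ = (Qᴴ * Q) * R * (U₀ᴴ * Polynomial.aeval A₀ q * U₀) := by rw [hQR]; noncomm_ring
        _ = _ := by rw [hQQ, Matrix.one_mul]
    rw [← h1, Matrix.mul_assoc _ R, Matrix.mul_nonsing_inv R hRdet, Matrix.mul_one]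
  have hRtri : (R⁻¹).BlockTriangular id := by
    let := R.invertibleOfIsUnitDet hRdet
    exact Matrix.blockTriangular_inv_of_blockTriangular hR
  refine ⟨U₀ * Q, (U₀ * Q)ᴴ * A * (U₀ * Q), ⟨hUQ, ?_, ?_⟩, ?_⟩
  · rw [hTR]
    exact fun i j hij => ((hR.mul htri).mul hRtri) hij
  · have : (U₀ * Q) * ((U₀ * Q)ᴴ * A * (U₀ * Q)) * (U₀ * Q)ᴴ =
        ((U₀ * Q) * (U₀ * Q)ᴴ) * A * ((U₀ * Q) * (U₀ * Q)ᴴ) := by noncomm_ring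
    rw [this, hUQ2, Matrix.one_mul, Matrix.mul_one]
  · have hUU : ‖U₀ * Q - U₀‖ ≤ C * K * ‖A - A₀‖ := by
      have : U₀ * Q - U₀ = U₀ * (Q - 1) := by rw [mul_sub, mul_one]
      rw [this, CStarRing.norm_mem_unitary_mul _ hU, mul_assoc]
      refine hQ1.trans ?_
      rw [hW1]
      gcongr
    have hTT := norm_conjTranspose_mul_mul_sub_le (A := A) (A₀ := A₀) hUQ hU
    rw [← hT₀] at hTT
    have h1 : 2 * ‖A₀‖ * ‖U₀ * Q - U₀‖ ≤ 2 * ‖A₀‖ * (C * K * ‖A - A₀‖) := by gcongr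
    linarith
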